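/- Theorem 2.1 (enumeration). Let $n,m\ge 1$ be integers. A plane labelled bipartite tree with $n$ white and $m$ black vertices is a tree embedded in the oriented plane, whose $n$ white vertices carry the distinct labels $v_1,\dots,v_n$, whose $m$ black vertices carry the distinct labels $u_1,\dots,u_m$, and in which every edge joins a white vertex to a black one. Two such trees are regarded as the same if some orientation-preserving homeomorphism of the plane carries one onto the other and respects all labels; equivalently, if their labelled vertices have the same adjacencies and around every vertex the adjacent vertices occur in the same counterclockwise cyclic order. (Thus a plane labelled bipartite tree is a tree on the vertex set $\{v_1,\dots,v_n\}\sqcup\{u_1,\dots,u_m\}$, all of whose edges join some $v_i$ to some $u_j$, together with a cyclic ordering of the neighbours of each vertex.) Then the number of plane labelled bipartite trees with $n$ white and $m$ black vertices is $$\frac{\bigl((n+m-2)!\bigr)^2}{(n-1)!\,(m-1)!}.$$ -/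

import Mathlib

/-- A plane labelled bipartite tree with `n` white and `m` black vertices.

The white vertices are identified with their labels `v_1, ..., v_n` (the elements of `Fin n`) and the
black vertices with their labels `u_1, ..., u_m` (the elements of `Fin m`), so two labelled trees are
the same (isomorphic through a label-preserving isomorphism) exactly when they are equal.

The embedding into the oriented plane, up to orientation-preserving homeomorphism, is recorded by the
rotation at each vertex `v`: the permutation `rot v` of the neighbours of `v` that sends each
neighbour to the next one in counterclockwise order around `v`. -/
structure PlaneLabelledBipartiteTree (n m : ℕ) where
  /-- the underlying graph -/
  graph : SimpleGraph (Fin n ⊕ Fin m)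
  /-- it is a tree (connected and acyclic) -/
  isTree : graph.IsTree
  /-- no two white vertices are adjacent -/
  not_adj_white : ∀ i j : Fin n, ¬ graph.Adj (Sum.inl i) (Sum.inl j)
  /-- no two black vertices are adjacent -/
  not_adj_black : ∀ i j : Fin m, ¬ graph.Adj (Sum.inr i) (Sum.inr j)
  /-- the next neighbour in counterclockwise order around a vertex -/
  rot : (v : Fin n ⊕ Fin m) → Equiv.Perm (graph.neighborSet v)
  /-- going around a vertex one meets all its neighbours: `rot v` is one single cycle on them -/
  rot_cyclic : ∀ (v : Fin n ⊕ Fin m) (x y : graph.neighborSet v), (rot v).SameCycle x y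

/-! A tree carries `∏ (deg x - 1)!` systems of rotations, since a `k`-set has `(k - 1)!` cyclic
orders. The number of bipartite trees with prescribed degrees is `(n-1)! (m-1)! / ∏ (deg x - 1)!`
(`ncard_coloredTrees_mul_prod_factorial`). The products cancel, so every admissible degree sequence
contributes exactly `(n-1)! (m-1)!` plane trees. The white excesses `deg - 1` sum to `m - 1` and the
black ones to `n - 1`, so stars and bars gives `choose (n+m-2) (m-1) * choose (n+m-2) (n-1)`
sequences. The count by degrees is an induction that deletes a leaf and sums over its neighbour. -/

namespace SimpleGraph

/-! ### Attaching and deleting a leaf -/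

variable {V : Type*}

/-- The graph obtained from a graph on the complement of `v` by attaching `v` as a leaf to `w`. -/
def attachLeaf (v : V) (w : {x // x ≠ v}) (G : SimpleGraph {x // x ≠ v}) : SimpleGraph V :=
  G.map (Function.Embedding.subtype _) ⊔ edge v w

lemma attachLeaf_adj {v : V} {w : {x // x ≠ v}} {G : SimpleGraph {x // x ≠ v}} {x y : V} :
    (attachLeaf v w G).Adj x y ↔
      (∃ (hx : x ≠ v) (hy : y ≠ v), G.Adj ⟨x, hx⟩ ⟨y, hy⟩) ∨
        (x = v ∧ y = w) ∨ (x = w ∧ y = v) := by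
  have hw := w.2
  simp only [attachLeaf, sup_adj, map_adj, Function.Embedding.subtype_apply, edge_adj,
    Subtype.exists]
  constructor
  · rintro (⟨a, ha, b, hb, h, rfl, rfl⟩ | ⟨h, -⟩)
    · exact Or.inl ⟨ha, hb, h⟩
    · exact Or.inr h
  · rintro (⟨hx, hy, h⟩ | h)
    · exact Or.inl ⟨x, hx, y, hy, h, rfl, rfl⟩
    · refine Or.inr ⟨h, ?_⟩
      rintro rfl
      rcases h with ⟨h1, h2⟩ | ⟨h1, h2⟩
      · exact hw (h2.symm.trans h1)
      · exact hw (h1.symm.trans h2)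

@[simp] lemma attachLeaf_adj_coe {v : V} {w : {x // x ≠ v}} {G : SimpleGraph {x // x ≠ v}}
    (x y : {x // x ≠ v}) : (attachLeaf v w G).Adj x y ↔ G.Adj x y := by
  rw [attachLeaf_adj]
  simp [x.2, y.2]

lemma comap_attachLeaf (v : V) (w : {x // x ≠ v}) (G : SimpleGraph {x // x ≠ v}) :
    (attachLeaf v w G).comap Subtype.val = G := by
  ext x y
  simp

lemma attachLeaf_comap {v : V} {w : {x // x ≠ v}} {G : SimpleGraph V}
    (h : G.neighborSet v = {w.1}) : attachLeaf v w (G.comap Subtype.val) = G := by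
  have hv : ∀ y, G.Adj v y ↔ y = w := fun y => by
    rw [← mem_neighborSet, h, Set.mem_singleton_iff]
  ext x y
  rw [attachLeaf_adj]
  by_cases hx : x = v
  · subst hx
    simp [hv, w.2.symm]
  · by_cases hy : y = v
    · subst hy
      simp [hx, G.adj_comm x y, hv]
    · simp [hx, hy]

lemma neighborSet_attachLeaf_self (v : V) (w : {x // x ≠ v}) (G : SimpleGraph {x // x ≠ v}) :
    (attachLeaf v w G).neighborSet v = {w.1} := by
  ext y
  simp [attachLeaf_adj, w.2.symm]

lemma ncard_neighborSet_attachLeaf [Finite V] [DecidableEq V] (v : V) (w : {x // x ≠ v})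
    (G : SimpleGraph {x // x ≠ v}) (x : {x // x ≠ v}) :
    ((attachLeaf v w G).neighborSet x).ncard =
      (G.neighborSet x).ncard + if x = w then 1 else 0 := by
  have hi : (Subtype.val '' G.neighborSet x).ncard = (G.neighborSet x).ncard :=
    Set.ncard_image_of_injective _ Subtype.val_injective
  split_ifs with hxw
  · subst hxw
    have : (attachLeaf v x G).neighborSet x = insert v (Subtype.val '' G.neighborSet x) := by
      ext y
      by_cases hy : y = v <;> simp [attachLeaf_adj, hy, x.2]
    rw [this, Set.ncard_insert_of_notMem (by simp), hi]
  · have : (attachLeaf v w G).neighborSet x = Subtype.val '' G.neighborSet x := by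
      ext y
      have : x.1 ≠ w.1 := fun h => hxw (Subtype.ext h)
      by_cases hy : y = v <;> simp [attachLeaf_adj, hy, x.2, this]
    rw [this, hi, add_zero]

lemma edgeSet_attachLeaf (v : V) (w : {x // x ≠ v}) (G : SimpleGraph {x // x ≠ v}) :
    (attachLeaf v w G).edgeSet =
      insert s(v, w.1) ((Function.Embedding.subtype _).sym2Map '' G.edgeSet) := by
  rw [attachLeaf, edgeSet_sup, edgeSet_map, edgeSet_edge_of_ne w.2.symm, Set.union_comm]
  rfl

/-- Every vertex still reaches `w`, and one vertex and one edge are added, so the edge count that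
characterises trees among connected graphs persists. -/
lemma IsTree.attachLeaf [Finite V] {v : V} {G : SimpleGraph {x // x ≠ v}} (hG : G.IsTree)
    (w : {x // x ≠ v}) : (attachLeaf v w G).IsTree := by
  classical
  rw [isTree_iff_connected_and_card] at hG ⊢
  obtain ⟨hc, hcard⟩ := hG
  constructor
  · have hw : ∀ x, (SimpleGraph.attachLeaf v w G).Reachable x w := by
      intro x
      by_cases hx : x = v
      · exact (attachLeaf_adj.2 (Or.inr (Or.inl ⟨hx, rfl⟩))).reachable
      · exact (hc.preconnected ⟨x, hx⟩ w).map
          (⟨Subtype.val, fun {a b} h => (attachLeaf_adj_coe a b).2 h⟩ : G →g _)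
    have : Nonempty V := ⟨v⟩
    exact ⟨fun x y => (hw x).trans (hw y).symm⟩
  · have hV : Nat.card V = Nat.card {x // x ≠ v} + 1 := by
      have := Fintype.ofFinite V
      rw [Nat.card_eq_fintype_card, Nat.card_eq_fintype_card, Fintype.card_subtype_compl,
        Fintype.card_subtype_eq]
      have : 0 < Fintype.card V := Fintype.card_pos_iff.2 ⟨v⟩
      omega
    rw [hV, ← hcard, Nat.card_coe_set_eq, Nat.card_coe_set_eq, edgeSet_attachLeaf,
      Set.ncard_insert_of_notMem, Set.ncard_image_of_injective _ (Function.Embedding.injective _)]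
    rintro ⟨e, -, he⟩
    have hv : v ∈ (Function.Embedding.subtype _).sym2Map e := he ▸ Sym2.mem_mk_left _ _
    simp at hv

lemma IsTree.comap_of_neighborSet_eq_singleton [Finite V] {G : SimpleGraph V} (hG : G.IsTree)
    {v : V} {w : {x // x ≠ v}} (h : G.neighborSet v = {w.1}) :
    (G.comap (Subtype.val : {x // x ≠ v} → V)).IsTree := by
  classical
  have := Fintype.ofFinite V
  refine ⟨?_, hG.isAcyclic.of_comap (Function.Embedding.subtype _)⟩
  refine Connected.induce_compl_singleton_of_degree_eq_one hG.connected (v := v) ?_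
  rw [← card_neighborSet_eq_degree, ← Nat.card_eq_fintype_card, Nat.card_coe_set_eq, h,
    Set.ncard_singleton]

/-! ### Two-coloured trees with prescribed degrees -/

/-- The trees properly coloured by `c` in which each vertex `x` has degree `k x`. -/
def coloredTrees (c : V → Bool) (k : V → ℕ) : Set (SimpleGraph V) :=
  {G | G.IsTree ∧ (∀ x y, G.Adj x y → c x ≠ c y) ∧ ∀ x, (G.neighborSet x).ncard = k x}

/-- Deleting the leaf `v` is a bijection, inverse to attaching it at `w`, and lowers only the degree
of `w`. By `hk` the subtraction is never truncated. -/
lemma ncard_coloredTrees_adj [Finite V] [DecidableEq V] (c : V → Bool) {k : V → ℕ}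
    (hk : ∀ x, 1 ≤ k x) {v : V} (hv : k v = 1) (w : {x // x ≠ v}) :
    {G ∈ coloredTrees c k | G.Adj v w}.ncard =
      if c v = c w then 0
      else (coloredTrees (fun x : {x // x ≠ v} => c x)
        (fun x => k x - if x = w then 1 else 0)).ncard := by
  split_ifs with hc
  · rw [Set.ncard_eq_zero]
    ext G
    simp only [Set.mem_ofPred_eq, Set.mem_empty_iff_false, iff_false]
    exact fun ⟨hG, h⟩ => hG.2.1 _ _ h hc
  have key : ∀ G ∈ {G ∈ coloredTrees c k | G.Adj v w}, G.neighborSet v = {w.1} := by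
    rintro G ⟨⟨-, -, hd⟩, hvw⟩
    obtain ⟨a, ha⟩ := Set.ncard_eq_one.1 ((hd v).trans hv)
    have : w.1 ∈ G.neighborSet v := hvw
    rw [ha, Set.mem_singleton_iff] at this
    rw [ha, this]
  refine Set.ncard_congr (fun G _ => G.comap Subtype.val) ?_ ?_ ?_
  · intro G hG
    have h1 := key G hG
    obtain ⟨⟨ht, hp, hd⟩, -⟩ := hG
    refine ⟨ht.comap_of_neighborSet_eq_singleton h1, fun x y h => hp _ _ h, fun x => ?_⟩
    have h2 := ncard_neighborSet_attachLeaf v w (G.comap Subtype.val) x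
    rw [attachLeaf_comap h1, hd] at h2
    dsimp only
    omega
  · intro G H hG hH h
    rw [← attachLeaf_comap (key G hG), ← attachLeaf_comap (key H hH)]
    exact congrArg _ h
  · rintro G ⟨ht, hp, hd⟩
    refine ⟨attachLeaf v w G, ⟨⟨ht.attachLeaf w, ?_, ?_⟩, ?_⟩, comap_attachLeaf v w G⟩
    · intro x y h
      rcases attachLeaf_adj.1 h with ⟨hx, hy, h⟩ | ⟨rfl, rfl⟩ | ⟨rfl, rfl⟩
      · exact hp _ _ h
      · exact hc
      · exact fun h => hc h.symm
    · intro x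
      by_cases hx : x = v
      · rw [hx, neighborSet_attachLeaf_self, Set.ncard_singleton, hv]
      · have h2 := ncard_neighborSet_attachLeaf v w G ⟨x, hx⟩
        have h3 := hk x
        rw [hd] at h2
        rw [h2]
        dsimp only
        split_ifs <;> omega
    · exact attachLeaf_adj.2 (Or.inr (Or.inl ⟨rfl, rfl⟩))

lemma ncard_coloredTrees_eq_sum [Fintype V] [DecidableEq V] (c : V → Bool) {k : V → ℕ}
    (hk : ∀ x, 1 ≤ k x) {v : V} (hv : k v = 1) :
    (coloredTrees c k).ncard = ∑ w : {x // x ≠ v},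
      if c v = c w then 0
      else (coloredTrees (fun x : {x // x ≠ v} => c x)
        (fun x => k x - if x = w then 1 else 0)).ncard := by
  simp_rw [← ncard_coloredTrees_adj c hk hv]
  have hU : coloredTrees c k = ⋃ w : {x // x ≠ v}, {G ∈ coloredTrees c k | G.Adj v w} := by
    ext G
    simp only [Set.mem_iUnion, Set.mem_ofPred_eq]
    refine ⟨fun h => ?_, fun ⟨_, h, _⟩ => h⟩
    obtain ⟨a, ha⟩ := Set.ncard_eq_one.1 ((h.2.2 v).trans hv)
    have : G.Adj v a := by rw [← mem_neighborSet, ha]; rfl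
    exact ⟨⟨a, this.ne'⟩, h, this⟩
  conv_lhs => rw [hU]
  rw [Set.ncard_iUnion_of_finite (fun _ => Set.toFinite _), finsum_eq_sum_of_fintype]
  intro w w' hne
  rw [Function.onFun, Set.disjoint_left]
  rintro G ⟨hG, h⟩ ⟨-, h'⟩
  obtain ⟨a, ha⟩ := Set.ncard_eq_one.1 ((hG.2.2 v).trans hv)
  rw [← mem_neighborSet, ha, Set.mem_singleton_iff] at h h'
  exact hne (Subtype.ext (h.trans h'.symm))

lemma coloredTrees_eq_empty {V : Type*} [Finite V] [Nontrivial V] (c : V → Bool) {k : V → ℕ}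
    {w : V} (hw : k w = 0) : coloredTrees c k = ∅ := by
  ext G
  simp only [Set.mem_empty_iff_false, iff_false]
  rintro ⟨ht, -, hd⟩
  obtain ⟨y, hy⟩ := ht.connected.preconnected.exists_adj_of_nontrivial w
  have h0 := hd w
  rw [hw, Set.ncard_eq_zero] at h0
  exact (h0 ▸ hy : y ∈ (∅ : Set V))

lemma ncard_coloredTrees_of_subsingleton {V : Type*} [Nonempty V] [Subsingleton V]
    (c : V → Bool) {k : V → ℕ} (hk : ∀ x, k x = 0) : (coloredTrees c k).ncard = 1 := by
  rw [Set.ncard_eq_one]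
  refine ⟨⊥, Set.eq_singleton_iff_unique_mem.2 ⟨⟨.of_subsingleton, ?_, ?_⟩, ?_⟩⟩
  · intro x y h
    exact absurd h (by simp)
  · intro x
    rw [hk, Set.ncard_eq_zero]
    ext y
    simp
  · intro G _
    exact Subsingleton.elim _ _

/-- The number of trees with a given proper 2-colouring and given degrees. -/
theorem ncard_coloredTrees_mul_prod_factorial {V : Type*} [Fintype V] (c : V → Bool) (d : V → ℕ)
    (h : ∀ b, (∑ x, if c x = b then d x else 0) + 1 = ∑ x, if c x = !b then 1 else 0) :
    (coloredTrees c (fun x => d x + 1)).ncard * ∏ x, (d x).factorial =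
      ∏ b, ((∑ x, if c x = b then 1 else 0) - 1).factorial := by
  classical
  induction hN : Fintype.card V generalizing V with
  | zero =>
    have := Fintype.card_eq_zero_iff.1 hN
    simpa using h true
  | succ N ih =>
    have htotal : (∑ x, d x) + 2 = Fintype.card V := by
      have h1 := h true
      have h2 := h false
      have h3 : ∑ x, d x = (∑ x, if c x = true then d x else 0) +
          ∑ x, if c x = false then d x else 0 := by
        rw [← Finset.sum_add_distrib]
        exact Finset.sum_congr rfl fun x _ => by cases c x <;> simp
      have h4 : Fintype.card V = (∑ x, if c x = true then 1 else 0) +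
          ∑ x, if c x = false then 1 else 0 := by
        rw [← Finset.sum_add_distrib, Fintype.card_eq_sum_ones]
        exact Finset.sum_congr rfl fun x _ => by cases c x <;> simp
      simp only [Bool.not_true, Bool.not_false] at h1 h2
      omega
    -- The excesses sum to less than the number of vertices, so some vertex is a leaf.
    obtain ⟨v, hv⟩ : ∃ v, d v = 0 := by
      by_contra! hne
      have : ∑ _x : V, 1 ≤ ∑ x, d x :=
        Finset.sum_le_sum fun x _ => Nat.one_le_iff_ne_zero.2 (hne x)
      rw [← Fintype.card_eq_sum_ones] at this
      omega
    have hcard : Fintype.card {x // x ≠ v} = N := by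
      rw [Fintype.card_subtype_compl, Fintype.card_subtype_eq, hN, Nat.add_sub_cancel]
    rw [ncard_coloredTrees_eq_sum c (fun x => Nat.le_add_left 1 (d x)) (by rw [hv] : d v + 1 = 1)]
    have hd : ∀ b, (∑ x, if c x = b then d x else 0) =
        ∑ x : {x // x ≠ v}, if c x = b then d x else 0 := fun b => by
      rw [Fintype.sum_eq_add_sum_subtype_ne _ v, hv, ite_self, zero_add]
    have hF : ∀ b, (∑ x, if c x = b then 1 else 0) = (if c v = b then 1 else 0) +
        ∑ x : {x // x ≠ v}, if c x = b then 1 else 0 := fun b =>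
      Fintype.sum_eq_add_sum_subtype_ne _ v
    have hprod : ∏ x, (d x).factorial = ∏ x : {x // x ≠ v}, (d x).factorial := by
      rw [Fintype.prod_eq_mul_prod_subtype_ne _ v, hv, Nat.factorial_zero, one_mul]
    have hnot : ∀ p q : Bool, p ≠ q → p = !q := by decide
    have hbool : ∀ f : Bool → ℕ, ∏ b, f b = f (c v) * f (!c v) := fun f => by
      cases c v <;> simp [mul_comm]
    -- `E` counts the remaining vertices by colour and `D` sums their excesses. As `v` has excess 0,
    -- deleting it alters `h` only through the size of its own colour class.
    set E := fun b => ∑ x : {x // x ≠ v}, if c x = b then 1 else 0 with hE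
    set D := fun b => ∑ x : {x // x ≠ v}, if c x = b then d x else 0 with hD
    have hb1 : D (c v) + 1 = E (!c v) := by
      have := h (c v)
      rw [hd, hF, if_neg (by simp), zero_add] at this
      exact this
    have hb2 : D (!c v) = E (c v) := by
      have := h (!c v)
      rw [hd, hF, Bool.not_not, if_pos rfl, add_comm] at this
      exact Nat.add_left_cancel this
    rw [hbool, hF, hF, if_pos rfl, if_neg (by simp), zero_add, Nat.add_sub_cancel_left, hprod,
      Finset.sum_mul]
    change _ = (E (c v)).factorial * (E (!c v) - 1).factorial
    -- If `v` was alone in its colour, a single vertex remains. Its degree is 0, not of the form `d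
    -- + 1`, so the induction hypothesis does not apply.
    by_cases hEv : E (c v) = 0
    · have hU : Fintype.card {x // x ≠ v} = 1 := by
        have : Fintype.card {x // x ≠ v} = E (c v) + E (!c v) := by
          rw [← Finset.sum_add_distrib, Fintype.card_eq_sum_ones]
          exact Finset.sum_congr rfl fun x _ => by cases c x <;> cases c v <;> simp
        have hD0 : D (c v) = 0 := by
          refine Finset.sum_eq_zero fun x hx => ?_
          have := Finset.sum_eq_zero_iff.1 hEv x hx
          exact if_neg fun h => by simp [h] at this
        omega
      obtain ⟨w, hw⟩ := Fintype.card_eq_one_iff.1 hU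
      let _ : Unique {x // x ≠ v} := ⟨⟨w⟩, hw⟩
      have hcw : c w ≠ c v := by
        have : (∑ x : {x // x ≠ v}, if c x = c v then 1 else 0) = 0 := hEv
        rw [Fintype.sum_unique] at this
        exact fun h => by simp [show (default : {x // x ≠ v}) = w from rfl, h] at this
      have hcw' : c w = !c v := hnot _ _ hcw
      have hdw : d w = 0 := by
        have : (∑ x : {x // x ≠ v}, if c x = !c v then d x else 0) = 0 := hb2.trans hEv
        rw [Fintype.sum_unique] at this
        exact (if_pos hcw').symm.trans this
      have hE1 : E (!c v) = 1 := by
        rw [hE]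
        dsimp only
        rw [Fintype.sum_unique]
        exact if_pos hcw'
      rw [Fintype.sum_unique, Fintype.prod_unique, hEv, hE1]
      change (if c v = c w then 0 else _) * (d w).factorial = _
      rw [if_neg hcw.symm, ncard_coloredTrees_of_subsingleton, hdw]
      · rfl
      · intro x
        rw [hw x]
        change d w + 1 - (if w = w then 1 else 0) = 0
        simp [hdw]
    -- Lowering `d w` by one divides the product of factorials by `d w`, so each neighbour `w` of
    -- the other colour contributes a multiple of `d w`.
    · have hterm : ∀ w : {x // x ≠ v}, (if c v = c w then 0
          else (coloredTrees (fun x : {x // x ≠ v} => c x)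
            (fun x => d x + 1 - if x = w then 1 else 0)).ncard) *
              ∏ x : {x // x ≠ v}, (d x).factorial =
          (if c w = !c v then d w else 0) *
            ((E (c v) - 1).factorial * (E (!c v) - 1).factorial) := by
        intro w
        have hiff : c w = (!c v) ↔ ¬ c v = c w := by cases c v <;> cases c w <;> simp
        by_cases hcw : c v = c w
        · rw [if_pos hcw, if_neg (by simpa [hiff] using hcw), zero_mul, zero_mul]
        rw [if_neg hcw, if_pos (hiff.2 hcw)]
        -- Here `w` would become isolated among at least two vertices: both sides vanish.
        by_cases hw0 : d w = 0
        · have : Nontrivial {x // x ≠ v} := by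
            obtain ⟨u, -, hu⟩ := Finset.exists_ne_zero_of_sum_ne_zero hEv
            refine ⟨u, w, ?_⟩
            rintro rfl
            exact hcw (of_not_not fun hne => hu (if_neg fun h => hne h.symm))
          rw [coloredTrees_eq_empty _ (w := w) (by simp [hw0])]
          simp [hw0]
        · have hdeg : (fun x : {x // x ≠ v} => d x + 1 - if x = w then 1 else 0) =
              fun x : {x // x ≠ v} => (d x - if x = w then 1 else 0) + 1 := by
            ext x
            split_ifs with hx
            · subst hx; omega
            · rfl
          have hsum : ∀ b, (∑ x : {x // x ≠ v}, if c x = b then d x - if x = w then 1 else 0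
              else 0) + (if c w = b then 1 else 0) = D b := by
            intro b
            have : (if c w = b then 1 else 0) = ∑ x : {x // x ≠ v},
                if x = w then (if c x = b then 1 else 0) else 0 := by simp
            rw [this, ← Finset.sum_add_distrib]
            refine Finset.sum_congr rfl fun x _ => ?_
            by_cases hx : x = w
            · subst hx
              split_ifs <;> omega
            · simp [hx]
          have hfac : ∏ x : {x // x ≠ v}, (d x).factorial =
              d w * ∏ x : {x // x ≠ v}, (d x - if x = w then 1 else 0).factorial := by
            rw [Fintype.prod_eq_mul_prod_subtype_ne _ w,
              Fintype.prod_eq_mul_prod_subtype_ne (fun x : {x // x ≠ v} =>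
                (d x - if x = w then 1 else 0).factorial) w, if_pos rfl, ← mul_assoc,
              Nat.mul_factorial_pred hw0]
            congr 1
            exact Finset.prod_congr rfl fun x _ => by rw [if_neg x.2, Nat.sub_zero]
          have hIH := ih (fun x : {x // x ≠ v} => c x)
            (fun x => d x - if x = w then 1 else 0) ?_ hcard
          · rw [hdeg, hfac, mul_left_comm, hIH, hbool]
          · intro b
            have h1 := hsum b
            change _ = E (!b)
            by_cases hb : b = c v
            · subst hb
              rw [if_neg (Ne.symm hcw), add_zero] at h1
              rw [h1, hb1]
            · have hb' : b = !c v := hnot _ _ hb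
              subst hb'
              rw [if_pos (hiff.2 hcw)] at h1
              rw [h1, hb2, Bool.not_not]
      rw [Finset.sum_congr rfl fun w _ => hterm w, ← Finset.sum_mul, ← mul_assoc]
      change D (!c v) * _ * _ = _
      -- The weights `d w` add up to `E (c v)`, which restores the missing factor of the factorial.
      rw [hb2, Nat.mul_factorial_pred hEv]

end SimpleGraph

/-! ### Cyclic orders of a finite set -/

theorem Equiv.Perm.card_forall_sameCycle (α : Type*) [Finite α] [Nonempty α] :
    Nat.card {σ : Equiv.Perm α // ∀ x y, σ.SameCycle x y} = (Nat.card α - 1).factorial := by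
  classical
  have := Fintype.ofFinite α
  rcases subsingleton_or_nontrivial α with h | h
  · have h1 : Nat.card α = 1 := Nat.card_eq_one_iff_unique.2 ⟨h, inferInstance⟩
    rw [h1, Nat.sub_self, Nat.factorial_zero, Nat.card_eq_one_iff_unique]
    exact ⟨⟨fun a b => Subtype.ext (Subsingleton.elim _ _)⟩,
      ⟨⟨1, fun x y => Subsingleton.elim x y ▸ Equiv.Perm.SameCycle.refl _ _⟩⟩⟩
  -- With two or more points, transitivity forbids fixed points and means a single cycle of full
  -- length. On one point the cycle type is empty, hence the separate case.
  · have hcard : 2 ≤ Fintype.card α := Fintype.one_lt_card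
    have key : ∀ σ : Equiv.Perm α, (∀ x y, σ.SameCycle x y) ↔
        σ.cycleType = {Fintype.card α} := by
      intro σ
      constructor
      · intro hσ
        have hmove : ∀ x, σ x ≠ x := by
          intro x hx
          obtain ⟨y, hy⟩ := exists_ne x
          exact hy (((hσ x y).eq_of_left hx).symm)
        have hc : σ.IsCycle := by
          obtain ⟨x⟩ := ‹Nonempty α›
          exact ⟨x, hmove x, fun y _ => hσ x y⟩
        have hs : σ.support = Finset.univ := by
          ext x; simp [hmove x]
        rw [hc.cycleType, hs, Finset.card_univ]
      · intro hσ x y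
        have hc : σ.IsCycle := by
          rw [← Equiv.Perm.card_cycleType_eq_one, hσ, Multiset.card_singleton]
        have hs : σ.support = Finset.univ := by
          rw [← Finset.card_eq_iff_eq_univ, ← Equiv.Perm.sum_cycleType, hσ, Multiset.sum_singleton]
        have hm : ∀ x, σ x ≠ x := fun x => by
          rw [← Equiv.Perm.mem_support, hs]; exact Finset.mem_univ x
        exact hc.sameCycle (hm x) (hm y)
    rw [Nat.card_congr (Equiv.subtypeEquivRight key), Nat.card_eq_fintype_card,
      Fintype.card_subtype, Equiv.Perm.card_of_cycleType_singleton hcard le_rfl,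
      Nat.choose_self, mul_one, Nat.card_eq_fintype_card]

/-! ### Plane trees, grouped by their degrees -/

namespace PlaneLabelledBipartiteTree

variable {n m : ℕ}

/-- The trees on `n` white and `m` black vertices with no monochromatic edge. -/
abbrev BipartiteTree (n m : ℕ) : Type :=
  {G : SimpleGraph (Fin n ⊕ Fin m) // G.IsTree ∧ ∀ x y, G.Adj x y → x.isLeft ≠ y.isLeft}

/-- A plane tree is a tree together with a cyclic ordering of the neighbours of each vertex. -/
def equivSigma (n m : ℕ) : PlaneLabelledBipartiteTree n m ≃
    Σ G : BipartiteTree n m, ∀ v, {σ : Equiv.Perm (G.1.neighborSet v) // ∀ x y, σ.SameCycle x y} where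
  toFun T := ⟨⟨T.graph, T.isTree, by
    rintro (i | i) (j | j) h
    · exact absurd h (T.not_adj_white i j)
    · simp
    · simp
    · exact absurd h (T.not_adj_black i j)⟩, fun v => ⟨T.rot v, T.rot_cyclic v⟩⟩
  invFun p :=
    { graph := p.1.1
      isTree := p.1.2.1
      not_adj_white := fun _ _ h => p.1.2.2 _ _ h rfl
      not_adj_black := fun _ _ h => p.1.2.2 _ _ h rfl
      rot := fun v => (p.2 v).1
      rot_cyclic := fun v => (p.2 v).2 }
  left_inv _ := rfl
  right_inv _ := rfl

lemma BipartiteTree.ncard_neighborSet_pos (hn : 1 ≤ n) (hm : 1 ≤ m) (G : BipartiteTree n m)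
    (v : Fin n ⊕ Fin m) : 0 < (G.1.neighborSet v).ncard := by
  have : Nontrivial (Fin n ⊕ Fin m) := ⟨.inl ⟨0, hn⟩, .inr ⟨0, hm⟩, Sum.inl_ne_inr⟩
  obtain ⟨y, hy⟩ := G.2.1.connected.preconnected.exists_adj_of_nontrivial v
  exact (Set.ncard_pos (Set.toFinite _)).2 ⟨y, hy⟩

/-- Each edge has one white and one black end, so both sums count the edges of the tree. -/
lemma BipartiteTree.sum_ncard_neighborSet (G : BipartiteTree n m) :
    ∑ i, (G.1.neighborSet (.inl i)).ncard + 1 = n + m ∧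
      ∑ j, (G.1.neighborSet (.inr j)).ncard + 1 = n + m := by
  classical
  have hb : G.1.IsBipartiteWith
      ((Finset.univ.map Function.Embedding.inl : Finset (Fin n ⊕ Fin m)) : Set (Fin n ⊕ Fin m))
      ((Finset.univ.map Function.Embedding.inr : Finset (Fin n ⊕ Fin m)) : Set _) := by
    refine ⟨?_, ?_⟩
    · rw [Set.disjoint_left]
      rintro (i | i) <;> simp
    · rintro (i | i) (j | j) h
      · exact (G.2.2 _ _ h rfl).elim
      · simp
      · simp
      · exact (G.2.2 _ _ h rfl).elim
  have hd : ∀ x, (G.1.neighborSet x).ncard = G.1.degree x := fun x => by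
    rw [← Nat.card_coe_set_eq, Nat.card_eq_fintype_card, SimpleGraph.card_neighborSet_eq_degree]
  have h1 := SimpleGraph.isBipartiteWith_sum_degrees_eq_card_edges hb
  have h2 := SimpleGraph.isBipartiteWith_sum_degrees_eq_card_edges' hb
  have h3 := G.2.1.card_edgeFinset
  rw [Finset.sum_map] at h1 h2
  change ∑ i, G.1.degree (Sum.inl i) = _ at h1
  change ∑ j, G.1.degree (Sum.inr j) = _ at h2
  simp only [hd, h1, h2, h3, Fintype.card_sum, Fintype.card_fin, and_self]

/-- The functions `x ↦ deg x - 1` that can occur for a tree on `n` white and `m` black vertices. -/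
abbrev DegreeData (n m : ℕ) : Type :=
  {f : Fin n → ℕ // ∑ i, f i = m - 1} × {f : Fin m → ℕ // ∑ j, f j = n - 1}

/-- The function `x ↦ deg x - 1` of a tree. -/
noncomputable def degreeData (hn : 1 ≤ n) (hm : 1 ≤ m) (G : BipartiteTree n m) : DegreeData n m :=
  (⟨fun i => (G.1.neighborSet (.inl i)).ncard - 1, by
    have h := G.sum_ncard_neighborSet.1
    have : ∑ i : Fin n, ((G.1.neighborSet (.inl i)).ncard - 1) + ∑ _i : Fin n, 1 =
        ∑ i : Fin n, (G.1.neighborSet (.inl i)).ncard := by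
      rw [← Finset.sum_add_distrib]
      exact Finset.sum_congr rfl fun i _ => Nat.sub_add_cancel (G.ncard_neighborSet_pos hn hm _)
    simp only [Finset.sum_const, Finset.card_univ, Fintype.card_fin, smul_eq_mul] at this
    dsimp only
    omega⟩,
  ⟨fun j => (G.1.neighborSet (.inr j)).ncard - 1, by
    have h := G.sum_ncard_neighborSet.2
    have : ∑ i : Fin m, ((G.1.neighborSet (.inr i)).ncard - 1) + ∑ _i : Fin m, 1 =
        ∑ i : Fin m, (G.1.neighborSet (.inr i)).ncard := by
      rw [← Finset.sum_add_distrib]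
      exact Finset.sum_congr rfl fun i _ => Nat.sub_add_cancel (G.ncard_neighborSet_pos hn hm _)
    simp only [Finset.sum_const, Finset.card_univ, Fintype.card_fin, smul_eq_mul] at this
    dsimp only
    omega⟩)

lemma card_sum_eq (k l : ℕ) :
    Nat.card {f : Fin k → ℕ // ∑ i, f i = l} = (k + l - 1).choose l := by
  rw [← Nat.card_congr (Sym.equivNatSumOfFintype (Fin k) l), Nat.card_eq_fintype_card,
    Sym.card_sym_eq_choose, Fintype.card_fin]

lemma card_degreeData (hn : 1 ≤ n) (hm : 1 ≤ m) :
    Nat.card (DegreeData n m) = (n + m - 2).choose (m - 1) * (n + m - 2).choose (n - 1) := by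
  rw [Nat.card_prod, card_sum_eq, card_sum_eq]
  congr 2 <;> omega

instance (k l : ℕ) : Finite {f : Fin k → ℕ // ∑ i, f i = l} :=
  Finite.of_equiv _ (Sym.equivNatSumOfFintype (Fin k) l)

lemma degreeData_eq_iff (hn : 1 ≤ n) (hm : 1 ≤ m) (G : BipartiteTree n m) (d : DegreeData n m) :
    degreeData hn hm G = d ↔
      ∀ x, (G.1.neighborSet x).ncard = Sum.elim d.1.1 d.2.1 x + 1 := by
  have hpos := G.ncard_neighborSet_pos hn hm
  simp only [degreeData, Prod.ext_iff, Subtype.ext_iff, funext_iff, Sum.forall, Sum.elim_inl,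
    Sum.elim_inr]
  refine and_congr (forall_congr' fun i => ?_) (forall_congr' fun i => ?_)
  · have := hpos (.inl i)
    omega
  · have := hpos (.inr i)
    omega

/-- The right side does not depend on `d`; this makes the sum over degree data collapse to a
product. -/
lemma card_fiber_degreeData (hn : 1 ≤ n) (hm : 1 ≤ m) (d : DegreeData n m) :
    Nat.card {G : BipartiteTree n m // degreeData hn hm G = d} *
        ∏ x, (Sum.elim d.1.1 d.2.1 x).factorial =
      (n - 1).factorial * (m - 1).factorial := by
  have h1 : Nat.card {G : BipartiteTree n m // degreeData hn hm G = d} =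
      (SimpleGraph.coloredTrees (Sum.isLeft : Fin n ⊕ Fin m → Bool)
        (fun x => Sum.elim d.1.1 d.2.1 x + 1)).ncard := by
    rw [← Nat.card_coe_set_eq]
    refine Nat.card_congr ((Equiv.subtypeEquivRight fun G => degreeData_eq_iff hn hm G d).trans
      ((Equiv.subtypeSubtypeEquivSubtypeInter _ (fun G : SimpleGraph (Fin n ⊕ Fin m) =>
        ∀ x, (G.neighborSet x).ncard = Sum.elim d.1.1 d.2.1 x + 1)).trans
        (Equiv.subtypeEquivRight fun G => and_assoc)))
  have h2 : ∀ b, (∑ x : Fin n ⊕ Fin m, if x.isLeft = b then 1 else 0) = if b then n else m := by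
    rintro (_ | _) <;> rw [Fintype.sum_sum_type] <;> simp
  rw [h1, SimpleGraph.ncard_coloredTrees_mul_prod_factorial]
  · simp only [h2, Fintype.prod_bool]
    simp
  · have h3 := d.1.2
    have h4 := d.2.2
    intro b
    rw [h2, Fintype.sum_sum_type]
    cases b <;> simp [h3, h4] <;> omega

theorem card_eq (hn : 1 ≤ n) (hm : 1 ≤ m) :
    Nat.card (PlaneLabelledBipartiteTree n m) =
      (n + m - 2).choose (m - 1) * (n + m - 2).choose (n - 1) *
        ((n - 1).factorial * (m - 1).factorial) := by
  classical
  have := Fintype.ofFinite (BipartiteTree n m)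
  have := Fintype.ofFinite (DegreeData n m)
  have hrot : ∀ G : BipartiteTree n m,
      Nat.card (∀ v, {σ : Equiv.Perm (G.1.neighborSet v) // ∀ x y, σ.SameCycle x y}) =
        ∏ v, ((G.1.neighborSet v).ncard - 1).factorial := fun G => by
    rw [Nat.card_pi]
    refine Finset.prod_congr rfl fun v _ => ?_
    have : Nonempty (G.1.neighborSet v) :=
      (Set.nonempty_of_ncard_ne_zero (G.ncard_neighborSet_pos hn hm v).ne').to_subtype
    rw [Equiv.Perm.card_forall_sameCycle, Nat.card_coe_set_eq]
  rw [Nat.card_congr (equivSigma n m), Nat.card_sigma, ← card_degreeData hn hm,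
    ← Fintype.sum_fiberwise (degreeData hn hm), Nat.card_eq_fintype_card, ← smul_eq_mul,
    ← Finset.card_univ, ← Finset.sum_const]
  refine Finset.sum_congr rfl fun d _ => ?_
  rw [← card_fiber_degreeData hn hm d, Nat.card_eq_fintype_card, ← smul_eq_mul,
    ← Finset.card_univ, ← Finset.sum_const]
  refine Finset.sum_congr rfl fun G _ => ?_
  rw [hrot]
  refine Finset.prod_congr rfl fun v _ => ?_
  rw [(degreeData_eq_iff hn hm G.1 d).1 G.2 v, Nat.add_sub_cancel]

end PlaneLabelledBipartiteTree

theorem theorem2p1 (n m : ℕ) (hn : 1 ≤ n) (hm : 1 ≤ m) :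
    (Nat.card (PlaneLabelledBipartiteTree n m) : ℚ) =
      ((Nat.factorial (n + m - 2) : ℚ)) ^ 2 /
        ((Nat.factorial (n - 1) : ℚ) * (Nat.factorial (m - 1) : ℚ)) := by
  obtain ⟨a, rfl⟩ := Nat.exists_eq_add_of_le' hn
  obtain ⟨b, rfl⟩ := Nat.exists_eq_add_of_le' hm
  rw [PlaneLabelledBipartiteTree.card_eq hn hm, show a + 1 + (b + 1) - 2 = a + b by omega,
    Nat.add_sub_cancel, Nat.add_sub_cancel]
  -- Both binomials equal `(a + b)! / (a! b!)`, so their product times `a! b!` is the claimed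
  -- quotient.
  have h1 := Nat.add_choose_mul_factorial_mul_factorial a b
  have h2 : (a + b).choose b = (a + b).choose a := (Nat.choose_symm_add).symm
  have ha := Nat.factorial_ne_zero a
  have hb := Nat.factorial_ne_zero b
  rw [← h2, eq_div_iff (by positivity), ← h1]
  push_cast
  ring
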